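/- Let $\mathbb H^{2,1}$ be the right $\mathbb H$-vector space $\mathbb H^3$ with the Hermitian form $\langle z,w\rangle=\bar w_3z_1+\bar w_2z_2+\bar w_1z_3$, let $\mathrm{Sp}(2,1)$ be its isometry group, and let $\partial\mathbf H^2_{\mathbb H}\subset\mathbb{HP}^2$ be the set of null lines. An element $A\in\mathrm{Sp}(2,1)$ is *loxodromic* if it fixes exactly two points of $\partial\mathbf H^2_{\mathbb H}$ and has no real right eigenvalue; a pair $(A,B)$ is *totally loxodromic* if $A$ and $B$ are loxodromic. A loxodromic $A$ has eigenvalue representatives $\lambda=re^{i\theta}$, $r^{-1}e^{i\theta}$, $\mu=e^{i\phi}$ with $0<r<1$, $\theta,\phi\in(0,\pi)$, whose eigen-points are the attracting fixed point $a_A\in\partial\mathbf H^2_{\mathbb H}$, the repelling fixed point $r_A\in\partial\mathbf H^2_{\mathbb H}$ and the polar point $x_A$, which is a positive line. *Real trace.* Writing $A=A_1+jA_2$ with $A_1,A_2\in M_3(\mathbb C)$ and $A_{\mathbb C}=\begin{pmatrix}A_1&-\overline{A_2}\\A_2&\overline{A_1}\end{pmatrix}$, the real trace $tr_{\mathbb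 R}(A)=(a,b,c)\in\mathbb R^3$ is defined by $\det(x-A_{\mathbb C})=x^6-ax^5+bx^4-cx^3+bx^2-ax+1$. *Configuration.* Let $\overline{\mathrm M}(2)$ be the set of $\mathrm{Sp}(2,1)$-congruence classes of ordered quadruples of points of $\partial\mathbf H^2_{\mathbb H}$, and $\mathrm M(2)\subset\overline{\mathrm M}(2)$ the configuration space of classes of quadruples of pairwise distinct points. The pair $(A,B)$ defines the class $m(A,B)=[(a_A,r_A,a_B,r_B)]$, which lies in $\mathrm M(2)$ if and only if $A$ and $B$ have no common fixed point on $\partial\mathbf H^2_{\mathbb H}$. *Projective points.* Let $\mathbb{CP}^1$ be the set of classes of nonzero quaternions under $q\sim qc$, $c\in\mathbb C\setminus\{0\}$. Fix, once and for all, an arbitrary lift $v_p\in\mathbb H^{2,1}$ of each $p\in\mathbb{HP}^2$, which identifies the line $p=v_p\mathbb H$ with $\mathbb H$, and an arbitrary reference quadruple in each class of $\overline{\mathrm M}(2)$. The projective points of a loxodromic $A$ are $p_1(A)=[q_1]$ and $p_2(A)=[q_2]$ in $\mathbb{CP}^1$, where $A(v_pq_1)=v_pq_1\lambda$ with $p=a_A$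 and $A(v_pq_2)=v_pq_2\mu$ with $p=x_A$; that is, they are the complex lines $\{x: Ax=x\lambda\}$ and $\{x: Ax=x\mu\}$ in the respective eigen-lines. For a pair, projective points are taken in normalized position: $(P_1,P_2,P_3,P_4)\in(\mathbb{CP}^1)^4$ are projective points of $(A,B)$ if for some $g\in\mathrm{Sp}(2,1)$ carrying $(a_A,r_A,a_B,r_B)$ to the reference quadruple of its class they equal $p_1(gAg^{-1}),p_2(gAg^{-1}),p_1(gBg^{-1}),p_2(gBg^{-1})$. **Theorem.** A totally loxodromic pair $(A,B)$ in $\mathrm{Sp}(2,1)$ is uniquely determined up to simultaneous conjugation in $\mathrm{Sp}(2,1)$ by the parameters $tr_{\mathbb R}(A)$, $tr_{\mathbb R}(B)$, the point $m(A,B)$ corresponding to $(a_A,r_A,a_B,r_B)$, and the four projective points $(p_1(A),p_2(A))$, $(p_1(B),p_2(B))$. Precisely: every totally loxodromic pair has such a system of parameters, and for totally loxodromic pairs $(A,B)$ and $(A',B')$ the following are equivalent: (i) there is $g\in\mathrm{Sp}(2,1)$ with $gAg^{-1}=A'$ and $gBg^{-1}=B'$; (ii) $(A,B)$ and $(A',B')$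 have a common system of parameters; (iii) $(A,B)$ and $(A',B')$ have the same systems of parameters. -/

import Mathlib

open scoped Quaternion Matrix LinearAlgebra.Projectivization

noncomputable section

namespace QuatHyp

/-! ### The group `Sp(2,1)` and the quaternionic projective plane -/

/-- `ℍ³`, a right vector space over the quaternions: the scalar `q` acts on `v` as
`MulOpposite.op q • v = (vᵢ q)ᵢ`. -/
abbrev V : Type := Fin 3 → ℍ[ℝ]

/-- The matrix of the Hermitian form of signature `(2,1)` (Siegel domain model). -/
def H₁ : Matrix (Fin 3) (Fin 3) ℍ[ℝ] := !![0, 0, 1; 0, 1, 0; 1, 0, 0]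

/-- The Hermitian form `⟨z, w⟩ = w* H₁ z`. -/
def herm (z w : V) : ℍ[ℝ] := star w ⬝ᵥ (H₁ *ᵥ z)

/-- `Sp(2,1)`: the invertible quaternionic matrices `A` with `A* H₁ A = H₁`. -/
def Sp21 : Subgroup (Matrix (Fin 3) (Fin 3) ℍ[ℝ])ˣ where
  carrier := {A | (A : Matrix (Fin 3) (Fin 3) ℍ[ℝ])ᴴ * H₁ * A = H₁}
  one_mem' := by simp
  mul_mem' := by
    intro A B hA hB
    simp only [Set.mem_ofPred_eq, Units.val_mul, Matrix.conjTranspose_mul] at *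
    calc _ = (B : Matrix (Fin 3) (Fin 3) ℍ[ℝ])ᴴ *
          ((A : Matrix (Fin 3) (Fin 3) ℍ[ℝ])ᴴ * H₁ * A) * B := by simp only [mul_assoc]
      _ = H₁ := by rw [hA, hB]
  inv_mem' := by
    intro A hA
    simp only [Set.mem_ofPred_eq] at *
    have h1 : (A : Matrix (Fin 3) (Fin 3) ℍ[ℝ]) * (A⁻¹ : (Matrix (Fin 3) (Fin 3) ℍ[ℝ])ˣ) = 1 := by
      simp
    have h2 : ((A⁻¹ : (Matrix (Fin 3) (Fin 3) ℍ[ℝ])ˣ) : Matrix (Fin 3) (Fin 3) ℍ[ℝ])ᴴ *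
        (A : Matrix (Fin 3) (Fin 3) ℍ[ℝ])ᴴ = 1 := by
      rw [← Matrix.conjTranspose_mul, h1, Matrix.conjTranspose_one]
    conv_lhs => rw [← hA]
    calc _ = (((A⁻¹ : (Matrix (Fin 3) (Fin 3) ℍ[ℝ])ˣ) : Matrix (Fin 3) (Fin 3) ℍ[ℝ])ᴴ *
        (A : Matrix (Fin 3) (Fin 3) ℍ[ℝ])ᴴ) * H₁ * ((A : Matrix (Fin 3) (Fin 3) ℍ[ℝ]) *
          (A⁻¹ : (Matrix (Fin 3) (Fin 3) ℍ[ℝ])ˣ)) := by simp only [mul_assoc]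
      _ = H₁ := by rw [h1, h2, one_mul, mul_one]

/-- The underlying matrix of an element of `Sp(2,1)`. -/
abbrev mat (A : Sp21) : Matrix (Fin 3) (Fin 3) ℍ[ℝ] :=
  ((A : (Matrix (Fin 3) (Fin 3) ℍ[ℝ])ˣ) : Matrix (Fin 3) (Fin 3) ℍ[ℝ])

/-- The quaternionic projective plane of right lines in `ℍ³`, with the action of `Sp(2,1)`
induced by `(A, v) ↦ A v` (matrix times column vector). -/
abbrev HP2 : Type := ℙ (ℍ[ℝ])ᵐᵒᵖ V

/-- The boundary of the quaternionic hyperbolic plane: the null lines. -/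
def boundary : Set HP2 :=
  {p | ∃ (v : V) (hv : v ≠ 0), Projectivization.mk (ℍ[ℝ])ᵐᵒᵖ v hv = p ∧ herm v v = 0}

/-- The points of `HP²` spanned by positive vectors. -/
def positivePoints : Set HP2 :=
  {p | ∃ (v : V) (hv : v ≠ 0), Projectivization.mk (ℍ[ℝ])ᵐᵒᵖ v hv = p ∧ 0 < (herm v v).re}

/-! ### Loxodromic elements and their fixed points -/

/-- `p` is an eigen-point of `A` with right eigenvalue `lam`: `A v = v lam` for some lift `v` of
`p`. -/
def IsEigenpoint (A : Sp21) (p : HP2) (lam : ℍ[ℝ]) : Prop :=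
  ∃ (v : V) (hv : v ≠ 0), Projectivization.mk (ℍ[ℝ])ᵐᵒᵖ v hv = p ∧
    mat A *ᵥ v = MulOpposite.op lam • v

/-- `A` fixes exactly two points of the boundary. -/
def IsHyperbolic (A : Sp21) : Prop := {p ∈ boundary | A • p = p}.ncard = 2

/-- A loxodromic element is a hyperbolic element without real eigenvalues. -/
def IsLoxodromic (A : Sp21) : Prop :=
  IsHyperbolic A ∧ ∀ (p : HP2) (lam : ℍ[ℝ]), IsEigenpoint A p lam → ∀ t : ℝ, lam ≠ (t : ℍ[ℝ])

/-- A pair is totally loxodromic if both members are loxodromic. -/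
def TotallyLoxodromic (A B : Sp21) : Prop := IsLoxodromic A ∧ IsLoxodromic B

/-- `p` is the attracting fixed point of `A` (eigenvalue class of modulus less than one). -/
def IsAttracting (A : Sp21) (p : HP2) : Prop :=
  p ∈ boundary ∧ ∃ lam : ℍ[ℝ], ‖lam‖ < 1 ∧ IsEigenpoint A p lam

/-- `p` is the repelling fixed point of `A` (eigenvalue class of modulus greater than one). -/
def IsRepelling (A : Sp21) (p : HP2) : Prop :=
  p ∈ boundary ∧ ∃ lam : ℍ[ℝ], 1 < ‖lam‖ ∧ IsEigenpoint A p lam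

/-- `p` is the polar point of `A` (positive, eigenvalue class of modulus one). -/
def IsPolar (A : Sp21) (p : HP2) : Prop :=
  p ∈ positivePoints ∧ ∃ lam : ℍ[ℝ], ‖lam‖ = 1 ∧ IsEigenpoint A p lam

/-! ### The real trace -/

/-- With `q = c₁ + j c₂` and `c₁, c₂` complex, this is `c₁`. -/
def complexPart₁ (q : ℍ[ℝ]) : ℂ := ⟨q.re, q.imI⟩

/-- With `q = c₁ + j c₂` and `c₁, c₂` complex, this is `c₂`. -/
def complexPart₂ (q : ℍ[ℝ]) : ℂ := ⟨q.imJ, -q.imK⟩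

/-- The complex representation of `A = A₁ + j A₂`, a complex `6 × 6` matrix with block rows
`(A₁, -conj A₂)` and `(A₂, conj A₁)`. -/
def toComplex (A : Matrix (Fin 3) (Fin 3) ℍ[ℝ]) : Matrix (Fin 3 ⊕ Fin 3) (Fin 3 ⊕ Fin 3) ℂ :=
  Matrix.fromBlocks (A.map complexPart₁) (-(A.map fun q => star (complexPart₂ q)))
    (A.map complexPart₂) (A.map fun q => star (complexPart₁ q))

/-- The real trace `(a, b, c)`: the characteristic polynomial of the complex representation is
`x⁶ - a x⁵ + b x⁴ - c x³ + b x² - a x + 1`. -/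
def realTrace (A : Sp21) : ℝ × ℝ × ℝ :=
  (-((toComplex (mat A)).charpoly.coeff 5).re, ((toComplex (mat A)).charpoly.coeff 4).re,
    -((toComplex (mat A)).charpoly.coeff 3).re)

/-! ### Configurations of boundary quadruples -/

/-- Ordered quadruples of boundary points (coincidences allowed). -/
abbrev Quadruple : Type := {p : Fin 4 → HP2 // ∀ i, p i ∈ boundary}

/-- `Sp(2,1)`-congruence of ordered quadruples. -/
instance congruence : Setoid Quadruple where
  r p q := ∃ g : Sp21, ∀ i, g • p.1 i = q.1 i
  iseqv :=
    { refl := fun _ => ⟨1, fun _ => one_smul _ _⟩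
      symm := by
        rintro p q ⟨g, hg⟩
        exact ⟨g⁻¹, fun i => by rw [← hg i, inv_smul_smul]⟩
      trans := by
        rintro p q r ⟨g, hg⟩ ⟨h, hh⟩
        exact ⟨h * g, fun i => by rw [mul_smul, hg i, hh i]⟩ }

/-- Congruence classes of ordered quadruples of boundary points. -/
abbrev Configuration : Type := Quotient congruence

/-- The configuration space `M(2)` of congruence classes of ordered quadruples of pairwise
distinct boundary points. -/
def M2 : Set Configuration := {m | ∃ q : Quadruple, Function.Injective q.1 ∧ ⟦q⟧ = m}

/-- `q` is the quadruple `(a_A, r_A, a_B, r_B)`. -/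
def IsFixedQuadruple (A B : Sp21) (q : Quadruple) : Prop :=
  IsAttracting A (q.1 0) ∧ IsRepelling A (q.1 1) ∧ IsAttracting B (q.1 2) ∧ IsRepelling B (q.1 3)

/-! ### Projective points -/

/-- Two nonzero quaternions are equivalent if they differ by a complex factor on the right. -/
instance complexLine : Setoid {q : ℍ[ℝ] // q ≠ 0} where
  r q q' := ∃ c : ℂ, c ≠ 0 ∧ q'.1 = q.1 * (c : ℍ[ℝ])
  iseqv :=
    { refl := fun q => ⟨1, one_ne_zero, by simp⟩
      symm := by
        rintro q q' ⟨c, hc, h⟩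
        refine ⟨c⁻¹, inv_ne_zero hc, ?_⟩
        rw [h, mul_assoc, ← Quaternion.coeComplex_mul, mul_inv_cancel₀ hc]
        simp
      trans := by
        rintro q q' q'' ⟨c, hc, h⟩ ⟨d, hd, h'⟩
        exact ⟨c * d, mul_ne_zero hc hd, by
          rw [h', h, mul_assoc, ← Quaternion.coeComplex_mul]⟩ }

/-- The complex projective line, as the set of complex lines in `ℍ = ℂ²`. -/
abbrev CP1 : Type := Quotient complexLine

/-- The choices needed to give coordinates to projective points: a representative quadruple for
each congruence class, and a lift of each point of `HP²`; the lift `v` of `p` identifies the line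
`p = vℍ` with `ℍ`. -/
structure Reference where
  quad : Configuration → Quadruple
  quad_class : ∀ m, ⟦quad m⟧ = m
  lift : HP2 → V
  lift_ne_zero : ∀ p, lift p ≠ 0
  mk_lift : ∀ p, Projectivization.mk (ℍ[ℝ])ᵐᵒᵖ (lift p) (lift_ne_zero p) = p

/-- `P` is the projective point of `A` at the eigen-point `p = vℍ` for the complex eigenvalue
representative `lam`: the eigenset `{x ∈ vℍ | A x = x lam}` is the complex line `v q ℂ`, where
`P` is the class of `q`. -/
def IsProjectivePoint (R : Reference) (A : Sp21) (p : HP2) (lam : ℂ) (P : CP1) : Prop :=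
  ∃ q : {q : ℍ[ℝ] // q ≠ 0}, P = ⟦q⟧ ∧
    mat A *ᵥ (MulOpposite.op q.1 • R.lift p) =
      MulOpposite.op (lam : ℍ[ℝ]) • (MulOpposite.op q.1 • R.lift p)

/-- `P` is the first projective point `p₁(A)`, that of the eigenvalue representative `r e^{iθ}`
with `r < 1` and `θ ∈ [0, π]`, at the attracting fixed point. -/
def IsFirstProjectivePoint (R : Reference) (A : Sp21) (P : CP1) : Prop :=
  ∃ (p : HP2) (lam : ℂ), IsAttracting A p ∧ ‖lam‖ < 1 ∧ 0 ≤ lam.im ∧ IsProjectivePoint R A p lam P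

/-- `P` is the second projective point `p₂(A)`, that of the eigenvalue representative `e^{iφ}`
with `φ ∈ [0, π]`, at the polar point. -/
def IsSecondProjectivePoint (R : Reference) (A : Sp21) (P : CP1) : Prop :=
  ∃ (p : HP2) (mu : ℂ), IsPolar A p ∧ ‖mu‖ = 1 ∧ 0 ≤ mu.im ∧ IsProjectivePoint R A p mu P

/-! ### The parameters of a pair -/

/-- Values for the parameters: two real traces, a configuration, four points of `CP¹`. -/
structure Parameters where
  trA : ℝ × ℝ × ℝ
  trB : ℝ × ℝ × ℝ
  config : Configuration
  p₁A : CP1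
  p₂A : CP1
  p₁B : CP1
  p₂B : CP1

/-- The parameters of `(A, B)`. The traces and the configuration are functions of the pair. The
projective points are read off after moving the pair by some `g`
so that its fixed points form the reference quadruple of their class. -/
def HasParameters (R : Reference) (A B : Sp21) (w : Parameters) : Prop :=
  realTrace A = w.trA ∧ realTrace B = w.trB ∧
  (∃ q : Quadruple, IsFixedQuadruple A B q ∧ ⟦q⟧ = w.config) ∧
  ∃ g : Sp21, IsFixedQuadruple (g * A * g⁻¹) (g * B * g⁻¹) (R.quad w.config) ∧
    IsFirstProjectivePoint R (g * A * g⁻¹) w.p₁A ∧ IsSecondProjectivePoint R (g * A * g⁻¹) w.p₂A ∧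
    IsFirstProjectivePoint R (g * B * g⁻¹) w.p₁B ∧ IsSecondProjectivePoint R (g * B * g⁻¹) w.p₂B

/-- Simultaneous conjugacy of pairs in `Sp(2,1)`. -/
def ConjugatePairs (A B A' B' : Sp21) : Prop :=
  ∃ g : Sp21, g * A * g⁻¹ = A' ∧ g * B * g⁻¹ = B'

end QuatHyp

end

open QuatHyp

/-!
An element with exactly two fixed points on the boundary has an attracting and a repelling one:
if `A v = v k` and `A w = w k` for null vectors with `⟨v, w⟩ = 1`, as happens when the eigenvalues
have norm one, then `v + w z` with `z` imaginary and commuting with `k` spans a third fixed point.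
The polar point is the unique point orthogonal to both. The projective points fix the lifts of the
attracting and polar points up to complex factors, which gives a frame in `Sp(2,1)`, common to all
elements with these fixed and projective points, in which they are diagonal with complex
eigenvalues `l, m, (star l)⁻¹` in the closed upper half plane, `‖l‖ < 1 = ‖m‖`. The characteristic
polynomial of the complex representation has exactly these eigenvalues and their conjugates as
roots, so the real trace recovers `l` and `m`, and with them the element.
-/

namespace QuatHyp

open MulOpposite Polynomial
open scoped RightActions

/-! ### Quaternions -/

theorem coeComplex_star (c : ℂ) : ((star c : ℂ) : ℍ[ℝ]) = star (c : ℍ[ℝ]) := by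
  ext <;> simp

theorem coeComplex_inv (c : ℂ) : ((c⁻¹ : ℂ) : ℍ[ℝ]) = (c : ℍ[ℝ])⁻¹ :=
  map_inv₀ Quaternion.ofComplex c

theorem norm_coeComplex (c : ℂ) : ‖(c : ℍ[ℝ])‖ = ‖c‖ := by
  rw [← mul_self_inj (norm_nonneg _) (norm_nonneg _), ← Quaternion.normSq_eq_norm_mul_self,
    Complex.norm_mul_self_eq_normSq, Quaternion.normSq_def', Complex.normSq_apply]
  simp [sq]

theorem inv_star_eq_self {q : ℍ[ℝ]} (hq : ‖q‖ = 1) : (star q)⁻¹ = q := by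
  refine inv_eq_of_mul_eq_one_right ?_
  rw [Quaternion.star_mul_self, Quaternion.normSq_eq_norm_mul_self, hq, mul_one,
    Quaternion.coe_one]

theorem norm_eq_of_mul_eq_mul {p q c : ℍ[ℝ]} (hq : q ≠ 0) (h : p * q = q * c) : ‖c‖ = ‖p‖ := by
  have h' : ‖p‖ * ‖q‖ = ‖q‖ * ‖c‖ := by rw [← norm_mul, h, norm_mul]
  rw [mul_comm] at h'
  exact (mul_left_cancel₀ (norm_ne_zero_iff.2 hq) h').symm

theorem exists_mul_eq_mul_coeComplex (p : ℍ[ℝ]) :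
    ∃ (q : ℍ[ℝ]) (c : ℂ), q ≠ 0 ∧ 0 ≤ c.im ∧ p * q = q * (c : ℍ[ℝ]) := by
  set u := p.im with hu
  set s : ℝ := ‖u‖
  set i : ℍ[ℝ] := (Complex.I : ℍ[ℝ]) with hi
  have i_mul_i : i * i = -1 := by
    rw [hi, ← Quaternion.coeComplex_mul, Complex.I_mul_I]
    ext <;> simp
  have u_mul_u : u * u = -(s * s) := by
    rw [← sq, hu, Quaternion.im_sq, Quaternion.normSq_eq_norm_mul_self, Quaternion.coe_mul]
  suffices ∃ q ≠ 0, u * q = q * (s * i) by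
    obtain ⟨q, hq, huq⟩ := this
    refine ⟨q, p.re + s * Complex.I, hq, by simp [s], ?_⟩
    rw [Quaternion.coeComplex_add, Quaternion.coeComplex_mul, Quaternion.coeComplex_coe,
      Quaternion.coeComplex_coe, mul_add, ← huq, ← Quaternion.coe_commutes, ← add_mul,
      Quaternion.re_add_im]
  -- `u + s i` intertwines `u` and `s i`, since both have square `-s²`; if it vanishes, `j` does.
  by_cases h : u + s * i = 0
  · have anticomm (q : ℍ[ℝ]) (h₀ : q.re = 0) (h₁ : q.imI = 0) : i * q = -(q * i) := by
      ext <;> simp [i, h₀, h₁]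
    let j : ℍ[ℝ] := ⟨0, 0, 1, 0⟩
    refine ⟨j, fun hj => one_ne_zero (congrArg QuaternionAlgebra.imJ hj), ?_⟩
    rw [eq_neg_of_add_eq_zero_left h, neg_mul, mul_assoc, anticomm j rfl rfl, mul_neg, neg_neg,
      ← mul_assoc, Quaternion.coe_commutes, mul_assoc]
  · refine ⟨u + s * i, h, ?_⟩
    rw [mul_add, add_mul, u_mul_u, add_comm, mul_assoc (s : ℍ[ℝ]), ← mul_assoc i,
      ← Quaternion.coe_commutes s i, mul_assoc (s : ℍ[ℝ]) i i, i_mul_i, mul_neg_one, mul_neg]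

theorem exists_imaginary_commute (p : ℍ[ℝ]) : ∃ z ≠ 0, star z = -z ∧ Commute p z := by
  by_cases hp : p.im = 0
  · refine ⟨(Complex.I : ℍ[ℝ]), ?_, ?_, ?_⟩
    · rw [← norm_ne_zero_iff, norm_coeComplex, Complex.norm_I]
      exact one_ne_zero
    · rw [← coeComplex_star, Complex.star_def, Complex.conj_I]
      ext <;> simp
    · rw [← Quaternion.re_add_im p, hp, add_zero]
      exact Quaternion.coe_commute _ _
  · refine ⟨p.im, hp, by simp, ?_⟩
    nth_rw 1 [← Quaternion.re_add_im p]
    exact (Quaternion.coe_commute _ _).add_left (Commute.refl _)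

/-! ### The Hermitian form -/

theorem mk_eq_mk_iff_smul_right {K W : Type*} [DivisionRing K] [AddCommGroup W] [Module Kᵐᵒᵖ W]
    {v w : W} (hv : v ≠ 0) (hw : w ≠ 0) :
    Projectivization.mk Kᵐᵒᵖ v hv = Projectivization.mk Kᵐᵒᵖ w hw ↔ ∃ q : K, v = w <• q := by
  rw [Projectivization.mk_eq_mk_iff', op_surjective.exists]
  simp only [eq_comm]

theorem herm_apply (z w : V) :
    herm z w = star (w 2) * z 0 + star (w 1) * z 1 + star (w 0) * z 2 := by
  simp [herm, H₁, Matrix.mulVec, dotProduct, Fin.sum_univ_three]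
  abel

theorem herm_smul_left (z w : V) (q : ℍ[ℝ]) : herm (z <• q) w = herm z w * q := by
  simp [herm_apply, add_mul, mul_assoc]

theorem herm_smul_right (z w : V) (q : ℍ[ℝ]) : herm z (w <• q) = star q * herm z w := by
  simp [herm_apply, mul_add, mul_assoc]

theorem herm_add_left (z z' w : V) : herm (z + z') w = herm z w + herm z' w := by
  simp only [herm, Matrix.mulVec_add, dotProduct_add]

theorem herm_add_right (z w w' : V) : herm z (w + w') = herm z w + herm z w' := by
  simp only [herm, star_add, add_dotProduct]

theorem star_herm (z w : V) : star (herm z w) = herm w z := by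
  simp [herm_apply]
  abel

theorem herm_comm_eq_zero {z w : V} : herm z w = 0 ↔ herm w z = 0 := by
  rw [← star_herm, star_eq_zero]

theorem herm_self_eq_re (z : V) : herm z z = ((herm z z).re : ℍ[ℝ]) :=
  Quaternion.star_eq_self.1 (star_herm z z)

theorem herm_smul_smul_self (z : V) (q : ℍ[ℝ]) :
    herm (z <• q) (z <• q) = ((herm z z).re * Quaternion.normSq q : ℝ) := by
  rw [herm_smul_left, herm_smul_right, herm_self_eq_re, ← Quaternion.coe_commutes, mul_assoc,
    Quaternion.star_mul_self, Quaternion.re_coe, Quaternion.coe_mul]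

theorem herm_mulVec (A : Sp21) (z w : V) : herm (mat A *ᵥ z) (mat A *ᵥ w) = herm z w := by
  have hA : (mat A)ᴴ * H₁ * mat A = H₁ := A.2
  rw [herm, herm, Matrix.star_mulVec, ← Matrix.dotProduct_mulVec, Matrix.mulVec_mulVec,
    Matrix.mulVec_mulVec, hA]

theorem herm_self_of_apply_two_eq_zero {u : V} (hu : u 2 = 0) :
    herm u u = Quaternion.normSq (u 1) := by
  simp [herm_apply, hu, Quaternion.star_mul_self]

theorem eq_smul_of_orthogonal_null {v x : V} (hv : v ≠ 0) (hvv : herm v v = 0)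
    (hxv : herm x v = 0) (hxx : (herm x x).re ≤ 0) : ∃ q : ℍ[ℝ], x = v <• q := by
  have apply_one_eq_zero {u : V} (h2 : u 2 = 0) (huu : (herm u u).re ≤ 0) : u 1 = 0 := by
    rw [herm_self_of_apply_two_eq_zero h2, Quaternion.re_coe] at huu
    exact Quaternion.normSq_eq_zero.1 (huu.antisymm Quaternion.normSq_nonneg)
  by_cases h2 : v 2 = 0
  · have h1 : v 1 = 0 := apply_one_eq_zero h2 (by simp [hvv])
    have h0 : v 0 ≠ 0 := fun h0 => hv (by ext1 i; fin_cases i <;> assumption)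
    have hx2 : x 2 = 0 := by simpa [herm_apply, h1, h2, h0] using hxv
    have hx1 : x 1 = 0 := apply_one_eq_zero hx2 hxx
    refine ⟨(v 0)⁻¹ * x 0, ?_⟩
    ext1 i
    fin_cases i <;> simp [h0, h1, h2, hx1, hx2]
  -- Subtracting a multiple of `v` from `x` does not change `⟨x, x⟩`, and makes the last coordinate
  -- vanish, where the form is positive semidefinite.
  · set u : V := x + v <• (-((v 2)⁻¹ * x 2)) with hu
    have hu2 : u 2 = 0 := by simp [hu, h2]
    have huv : herm u v = 0 := by
      rw [hu, herm_add_left, herm_smul_left, hxv, hvv, zero_mul, add_zero]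
    have huu : herm u u = herm x x := by
      nth_rw 2 [hu]
      rw [herm_add_right, herm_smul_right, huv, mul_zero, add_zero, hu, herm_add_left,
        herm_smul_left, herm_comm_eq_zero.1 hxv, zero_mul, add_zero]
    have hu1 : u 1 = 0 := apply_one_eq_zero hu2 (huu ▸ hxx)
    have hu0 : u 0 = 0 := by simpa [herm_apply, hu1, hu2, h2] using huv
    have hu_zero : u = 0 := by ext1 i; fin_cases i <;> assumption
    refine ⟨(v 2)⁻¹ * x 2, ?_⟩
    rwa [hu, op_neg, neg_smul, ← sub_eq_add_neg, sub_eq_zero] at hu_zero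

theorem exists_forall_orthogonal_iff {v w : V} (hvv : herm v v = 0) (hww : herm w w = 0)
    (hvw : herm v w ≠ 0) :
    ∃ x ≠ 0, ∀ y, herm y v = 0 ∧ herm y w = 0 ↔ ∃ q : ℍ[ℝ], y = x <• q := by
  let f : V →ₗ[(ℍ[ℝ])ᵐᵒᵖ] ℍ[ℝ] × ℍ[ℝ] :=
    { toFun := fun y => (herm y v, herm y w)
      map_add' := fun y z => by simp [herm_add_left]
      map_smul' := op_surjective.forall.2 fun q y => by simp [herm_smul_left] }
  have hwv : herm w v ≠ 0 := mt herm_comm_eq_zero.1 hvw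
  have hf : LinearMap.range f = ⊤ := LinearMap.range_eq_top.2 fun ⟨p, q⟩ =>
    ⟨w <• ((herm w v)⁻¹ * p) + v <• ((herm v w)⁻¹ * q), by
      simp only [f, LinearMap.coe_mk, AddHom.coe_mk, herm_add_left, herm_smul_left, hvv, hww,
        mul_inv_cancel_left₀ hvw, mul_inv_cancel_left₀ hwv, zero_mul, add_zero, zero_add]⟩
  have hℍ : Module.finrank (ℍ[ℝ])ᵐᵒᵖ ℍ[ℝ] = 1 :=
    finrank_eq_one 1 one_ne_zero fun q => ⟨op q, by simp⟩
  have : Module.Finite (ℍ[ℝ])ᵐᵒᵖ ℍ[ℝ] := Module.finite_of_finrank_eq_succ hℍ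
  have hker : Module.finrank (ℍ[ℝ])ᵐᵒᵖ (LinearMap.ker f) = 1 := by
    have := f.finrank_range_add_finrank_ker
    rw [hf, finrank_top, Module.finrank_prod, Module.finrank_pi_fintype] at this
    simp only [hℍ, Finset.sum_const, Finset.card_univ, Fintype.card_fin, smul_eq_mul] at this
    lia
  obtain ⟨⟨x, hx⟩, hx0, hspan⟩ := finrank_eq_one_iff'.1 hker
  have mem_ker (y : V) : y ∈ LinearMap.ker f ↔ herm y v = 0 ∧ herm y w = 0 := by simp [f]
  refine ⟨x, by simpa using hx0, fun y => ⟨fun hy => ?_, ?_⟩⟩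
  · obtain ⟨q, hq⟩ := hspan ⟨y, (mem_ker y).2 hy⟩
    exact ⟨q.unop, congrArg Subtype.val hq.symm⟩
  · rintro ⟨q, rfl⟩
    exact (mem_ker _).1 ((LinearMap.ker f).smul_mem (op q) hx)

/-! ### Orthogonality of points -/

/-- Orthogonality of points of `ℍP²` for the Hermitian form. The polar point of a hyperbolic
element is the only point orthogonal to both of its fixed points on the boundary. -/
def IsOrthogonal (p q : HP2) : Prop := herm p.rep q.rep = 0

theorem isOrthogonal_mk_iff {v w : V} (hv : v ≠ 0) (hw : w ≠ 0) :
    IsOrthogonal (Projectivization.mk (ℍ[ℝ])ᵐᵒᵖ v hv) (Projectivization.mk (ℍ[ℝ])ᵐᵒᵖ w hw) ↔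
      herm v w = 0 := by
  obtain ⟨a, ha⟩ := (mk_eq_mk_iff_smul_right (K := ℍ[ℝ]) hv
    (Projectivization.mk (ℍ[ℝ])ᵐᵒᵖ v hv).rep_nonzero).1 (Projectivization.mk_rep _).symm
  obtain ⟨b, hb⟩ := (mk_eq_mk_iff_smul_right (K := ℍ[ℝ]) hw
    (Projectivization.mk (ℍ[ℝ])ᵐᵒᵖ w hw).rep_nonzero).1 (Projectivization.mk_rep _).symm
  have ha0 : a ≠ 0 := by rintro rfl; exact hv (by simpa using ha)
  have hb0 : b ≠ 0 := by rintro rfl; exact hw (by simpa using hb)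
  conv_rhs => rw [ha, hb]
  simp [herm_smul_left, herm_smul_right, ha0, hb0, IsOrthogonal]

theorem mem_boundary_iff_isOrthogonal_self {p : HP2} : p ∈ boundary ↔ IsOrthogonal p p := by
  constructor
  · rintro ⟨v, hv, rfl, hvv⟩
    exact (isOrthogonal_mk_iff hv hv).2 hvv
  · exact fun h => ⟨p.rep, p.rep_nonzero, p.mk_rep, h⟩

theorem mk_mem_boundary_iff {v : V} (hv : v ≠ 0) :
    Projectivization.mk (ℍ[ℝ])ᵐᵒᵖ v hv ∈ boundary ↔ herm v v = 0 :=
  mem_boundary_iff_isOrthogonal_self.trans (isOrthogonal_mk_iff hv hv)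

theorem herm_self_pos_of_mk_mem_positivePoints {v : V} (hv : v ≠ 0)
    (h : Projectivization.mk (ℍ[ℝ])ᵐᵒᵖ v hv ∈ positivePoints) : 0 < (herm v v).re := by
  obtain ⟨u, hu, huv, huu⟩ := h
  obtain ⟨q, rfl⟩ := (mk_eq_mk_iff_smul_right hv hu).1 huv.symm
  have hq : q ≠ 0 := by rintro rfl; simp at hv
  rw [herm_smul_smul_self, Quaternion.re_coe]
  exact mul_pos huu (Quaternion.normSq_nonneg.lt_of_ne' (Quaternion.normSq_ne_zero.2 hq))

theorem not_isOrthogonal_self_of_mem_positivePoints {p : HP2} (hp : p ∈ positivePoints) :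
    ¬ IsOrthogonal p p := by
  obtain ⟨v, hv, rfl, hvv⟩ := hp
  rw [isOrthogonal_mk_iff hv hv]
  intro h
  simp [h] at hvv

theorem eq_or_mem_positivePoints_of_isOrthogonal {p a : HP2} (ha : a ∈ boundary)
    (h : IsOrthogonal p a) : p = a ∨ p ∈ positivePoints := by
  obtain ⟨v, hv, rfl, hvv⟩ := ha
  induction p using Projectivization.ind with | h x hx =>
  rw [isOrthogonal_mk_iff hx hv] at h
  refine or_iff_not_imp_right.2 fun hpos => (mk_eq_mk_iff_smul_right hx hv).2 ?_
  exact eq_smul_of_orthogonal_null hv hvv h (not_lt.1 fun hxx => hpos ⟨x, hx, rfl, hxx⟩)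

theorem eq_of_isOrthogonal_of_mem_boundary {a r : HP2} (ha : a ∈ boundary) (hr : r ∈ boundary)
    (h : IsOrthogonal a r) : a = r :=
  (eq_or_mem_positivePoints_of_isOrthogonal hr h).resolve_right fun hpos =>
    not_isOrthogonal_self_of_mem_positivePoints hpos (mem_boundary_iff_isOrthogonal_self.1 ha)

theorem mem_positivePoints_of_isOrthogonal {a r s : HP2} (ha : a ∈ boundary) (hr : r ∈ boundary)
    (hne : a ≠ r) (hsa : IsOrthogonal s a) (hsr : IsOrthogonal s r) : s ∈ positivePoints := by
  refine (eq_or_mem_positivePoints_of_isOrthogonal ha hsa).resolve_left ?_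
  rintro rfl
  exact hne (eq_of_isOrthogonal_of_mem_boundary ha hr hsr)

theorem existsUnique_isOrthogonal {a r : HP2} (ha : a ∈ boundary) (hr : r ∈ boundary)
    (hne : a ≠ r) : ∃! s, IsOrthogonal s a ∧ IsOrthogonal s r := by
  have hnot : ¬ IsOrthogonal a r := mt (eq_of_isOrthogonal_of_mem_boundary ha hr) hne
  obtain ⟨v, hv, rfl, hvv⟩ := ha
  obtain ⟨w, hw, rfl, hww⟩ := hr
  rw [isOrthogonal_mk_iff hv hw] at hnot
  obtain ⟨x, hx, hspan⟩ := exists_forall_orthogonal_iff hvv hww hnot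
  have hiff (y : V) (hy : y ≠ 0) : IsOrthogonal (.mk _ y hy) (.mk _ v hv) ∧
      IsOrthogonal (.mk _ y hy) (.mk _ w hw) ↔ ∃ q : ℍ[ℝ], y = x <• q := by
    rw [isOrthogonal_mk_iff hy hv, isOrthogonal_mk_iff hy hw, hspan]
  refine ⟨.mk _ x hx, (hiff x hx).2 ⟨1, by simp⟩, fun s hs => ?_⟩
  induction s using Projectivization.ind with | h y hy =>
  exact (mk_eq_mk_iff_smul_right hy hx).2 ((hiff y hy).1 hs)

theorem mulVec_ne_zero (A : Sp21) {v : V} (hv : v ≠ 0) : mat A *ᵥ v ≠ 0 :=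
  (smul_ne_zero_iff_ne A).2 hv

theorem smul_mk (A : Sp21) {v : V} (hv : v ≠ 0) :
    A • Projectivization.mk (ℍ[ℝ])ᵐᵒᵖ v hv =
      Projectivization.mk (ℍ[ℝ])ᵐᵒᵖ (mat A *ᵥ v) (mulVec_ne_zero A hv) := rfl

theorem IsOrthogonal.smul {p q : HP2} (h : IsOrthogonal p q) (A : Sp21) :
    IsOrthogonal (A • p) (A • q) := by
  induction p using Projectivization.ind with | h v hv =>
  induction q using Projectivization.ind with | h w hw =>
  rw [smul_mk, smul_mk, isOrthogonal_mk_iff, herm_mulVec]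
  exact (isOrthogonal_mk_iff hv hw).1 h

theorem smul_mem_boundary (A : Sp21) {p : HP2} (hp : p ∈ boundary) : A • p ∈ boundary :=
  mem_boundary_iff_isOrthogonal_self.2 ((mem_boundary_iff_isOrthogonal_self.1 hp).smul A)

/-! ### Eigenpoints -/

theorem mulVec_smul_right_of_mul_eq_mul {n S : Type*} [Fintype n] [Semiring S] {M : Matrix n n S}
    {v : n → S} {l q c : S} (h : M *ᵥ v = v <• l) (hq : l * q = q * c) :
    M *ᵥ (v <• q) = (v <• q) <• c := by
  rw [Matrix.mulVec_smul, h, op_smul_op_smul, hq, op_smul_op_smul]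

theorem exists_mulVec_smul_right {n : Type*} [Fintype n] {M : Matrix n n ℍ[ℝ]} {v : n → ℍ[ℝ]}
    {l q : ℍ[ℝ]} (h : M *ᵥ v = v <• l) (hq : q ≠ 0) :
    ∃ k : ℍ[ℝ], ‖k‖ = ‖l‖ ∧ M *ᵥ (v <• q) = (v <• q) <• k := by
  have e : l * q = q * (q⁻¹ * l * q) := by simp [mul_assoc, hq]
  exact ⟨q⁻¹ * l * q, norm_eq_of_mul_eq_mul hq e, mulVec_smul_right_of_mul_eq_mul h e⟩

theorem IsEigenpoint.exists_mulVec {A : Sp21} {p : HP2} {l : ℍ[ℝ]} (h : IsEigenpoint A p l)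
    {v : V} (hv : v ≠ 0) (hp : Projectivization.mk (ℍ[ℝ])ᵐᵒᵖ v hv = p) :
    ∃ k : ℍ[ℝ], ‖k‖ = ‖l‖ ∧ mat A *ᵥ v = v <• k := by
  obtain ⟨u, hu, rfl, hAu⟩ := h
  obtain ⟨q, rfl⟩ := (mk_eq_mk_iff_smul_right hv hu).1 hp
  exact exists_mulVec_smul_right hAu (by rintro rfl; simp at hv)

theorem smul_eq_self_iff_exists_isEigenpoint {A : Sp21} {p : HP2} :
    A • p = p ↔ ∃ l, IsEigenpoint A p l := by
  constructor
  · induction p using Projectivization.ind with | h v hv =>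
    rw [smul_mk, mk_eq_mk_iff_smul_right]
    exact fun ⟨l, hl⟩ => ⟨l, v, hv, rfl, hl⟩
  · rintro ⟨l, v, hv, rfl, hl⟩
    rw [smul_mk, mk_eq_mk_iff_smul_right]
    exact ⟨l, hl⟩

theorem IsEigenpoint.norm_eq {A : Sp21} {p : HP2} {l k : ℍ[ℝ]} (hl : IsEigenpoint A p l)
    (hk : IsEigenpoint A p k) : ‖l‖ = ‖k‖ := by
  obtain ⟨v, hv, rfl, hAv⟩ := hl
  obtain ⟨k', hk', hAv'⟩ := hk.exists_mulVec hv rfl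
  rw [← hk', op_injective (smul_left_injective _ hv (hAv.symm.trans hAv'))]

theorem IsEigenpoint.isOrthogonal {A : Sp21} {p q : HP2} {l k : ℍ[ℝ]} (hp : IsEigenpoint A p l)
    (hq : IsEigenpoint A q k) (h : ‖l‖ * ‖k‖ ≠ 1) : IsOrthogonal p q := by
  obtain ⟨v, hv, rfl, hAv⟩ := hp
  obtain ⟨w, hw, rfl, hAw⟩ := hq
  rw [isOrthogonal_mk_iff hv hw, ← norm_eq_zero]
  have invariance : ‖k‖ * (‖herm v w‖ * ‖l‖) = ‖herm v w‖ := by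
    rw [← norm_mul, ← herm_smul_left, ← norm_star k, ← norm_mul, ← herm_smul_right, ← hAv, ← hAw,
      herm_mulVec]
  by_contra hne
  exact h (mul_left_cancel₀ hne (by linear_combination invariance))

theorem IsEigenpoint.norm_mul_norm_eq_one {A : Sp21} {p q : HP2} {l k : ℍ[ℝ]}
    (hp : IsEigenpoint A p l) (hq : IsEigenpoint A q k) (hpb : p ∈ boundary) (hqb : q ∈ boundary)
    (hne : p ≠ q) : ‖l‖ * ‖k‖ = 1 := by
  by_contra h
  exact hne (eq_of_isOrthogonal_of_mem_boundary hpb hqb (hp.isOrthogonal hq h))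

/-! ### Fixed points of hyperbolic elements -/

theorem exists_third_null_eigenvector {A : Sp21} {v w : V} {k : ℍ[ℝ]} (hvv : herm v v = 0)
    (hww : herm w w = 0) (hvw : herm v w = 1) (hv : mat A *ᵥ v = v <• k)
    (hw : mat A *ᵥ w = w <• k) :
    ∃ u, herm u u = 0 ∧ herm u v ≠ 0 ∧ herm u w ≠ 0 ∧ mat A *ᵥ u = u <• k := by
  obtain ⟨z, hz, hstar, hcomm⟩ := exists_imaginary_commute k
  have hwv : herm w v = 1 := by rw [← star_herm, hvw, star_one]
  have huv : herm (v + w <• z) v = z := by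
    rw [herm_add_left, herm_smul_left, hvv, hwv, one_mul, zero_add]
  have huw : herm (v + w <• z) w = 1 := by
    rw [herm_add_left, herm_smul_left, hvw, hww, zero_mul, add_zero]
  refine ⟨v + w <• z, ?_, by rwa [huv], by rw [huw]; exact one_ne_zero, ?_⟩
  · rw [herm_add_right, herm_smul_right, huw, huv, hstar, mul_one, add_neg_cancel]
  · rw [Matrix.mulVec_add, mulVec_smul_right_of_mul_eq_mul hw hcomm, hv, smul_add]

theorem eigenvalue_eq_inv_star {A : Sp21} {v w : V} {l k : ℍ[ℝ]} (hvw : herm v w = 1)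
    (hv : mat A *ᵥ v = v <• l) (hw : mat A *ᵥ w = w <• k) : k = (star l)⁻¹ := by
  have e : star k * l = 1 := by
    rw [← hvw, ← herm_mulVec A, hv, hw, herm_smul_left, herm_smul_right, hvw, mul_one]
  apply eq_inv_of_mul_eq_one_right
  rw [← star_one, ← e, star_mul, star_star]

theorem exists_third_fixed_point {A : Sp21} {p q : HP2} {l : ℍ[ℝ]} (hp : p ∈ boundary)
    (hq : q ∈ boundary) (hpq : p ≠ q) (hl : ‖l‖ = 1) (hAp : IsEigenpoint A p l)
    (hAq : A • q = q) : ∃ s ∈ boundary, A • s = s ∧ s ≠ p ∧ s ≠ q := by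
  have hnot : ¬ IsOrthogonal p q := mt (eq_of_isOrthogonal_of_mem_boundary hp hq) hpq
  have ne_of_not {s t : HP2} (ht : t ∈ boundary) (hst : ¬ IsOrthogonal s t) : s ≠ t := by
    rintro rfl
    exact hst (mem_boundary_iff_isOrthogonal_self.1 ht)
  obtain ⟨m, w₀, hw₀, rfl, hAw₀⟩ := smul_eq_self_iff_exists_isEigenpoint.1 hAq
  obtain ⟨v, hv, rfl, hAv⟩ := hAp
  rw [isOrthogonal_mk_iff hv hw₀] at hnot
  set c := star (herm v w₀)⁻¹ with hc
  have hc0 : c ≠ 0 := by simpa [hc] using hnot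
  have hvw : herm v (w₀ <• c) = 1 := by rw [herm_smul_right, hc, star_star, inv_mul_cancel₀ hnot]
  have hww : herm (w₀ <• c) (w₀ <• c) = 0 := by
    rw [herm_smul_left, herm_smul_right, (mk_mem_boundary_iff hw₀).1 hq, mul_zero, zero_mul]
  obtain ⟨k, -, hk⟩ := exists_mulVec_smul_right hAw₀ hc0
  obtain rfl : k = l := (eigenvalue_eq_inv_star hvw hAv hk).trans (inv_star_eq_self hl)
  obtain ⟨u, huu, huv, huw, hAu⟩ :=
    exists_third_null_eigenvector ((mk_mem_boundary_iff hv).1 hp) hww hvw hAv hk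
  have hu : u ≠ 0 := by rintro rfl; simp [herm_apply] at huv
  refine ⟨Projectivization.mk _ u hu, (mk_mem_boundary_iff hu).2 huu,
    smul_eq_self_iff_exists_isEigenpoint.2 ⟨k, u, hu, rfl, hAu⟩, ne_of_not hp ?_, ne_of_not hq ?_⟩
  · rwa [isOrthogonal_mk_iff hu hv]
  · rw [isOrthogonal_mk_iff hu hw₀]
    intro h
    rw [herm_smul_right, h, mul_zero] at huw
    exact huw rfl

theorem IsHyperbolic.exists_attracting_repelling {A : Sp21} (hA : IsHyperbolic A) :
    ∃ a r, IsAttracting A a ∧ IsRepelling A r := by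
  obtain ⟨p, q, hpq, hfix⟩ := Set.ncard_eq_two.1 hA
  obtain ⟨hp, hAp⟩ : p ∈ {p ∈ boundary | A • p = p} := by simp [hfix]
  obtain ⟨hq, hAq⟩ : q ∈ {p ∈ boundary | A • p = p} := by simp [hfix]
  obtain ⟨l, hl⟩ := smul_eq_self_iff_exists_isEigenpoint.1 hAp
  obtain ⟨k, hk⟩ := smul_eq_self_iff_exists_isEigenpoint.1 hAq
  have hlk : ‖l‖ * ‖k‖ = 1 := hl.norm_mul_norm_eq_one hk hp hq hpq
  rcases lt_trichotomy ‖l‖ 1 with h | h | h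
  · exact ⟨p, q, ⟨hp, l, h, hl⟩, hq, k, by nlinarith [norm_nonneg l], hk⟩
  · obtain ⟨s, hs, hAs, hsp, hsq⟩ := exists_third_fixed_point hp hq hpq h hl hAq
    have : s ∈ ({p, q} : Set HP2) := hfix ▸ ⟨hs, hAs⟩
    exact absurd this (by simp [hsp, hsq])
  · exact ⟨q, p, ⟨hq, k, by nlinarith [norm_nonneg k], hk⟩, hp, l, h, hl⟩

theorem IsAttracting.unique {A : Sp21} {p q : HP2} (hp : IsAttracting A p)
    (hq : IsAttracting A q) : p = q := by
  obtain ⟨hpb, l, hl, hpl⟩ := hp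
  obtain ⟨hqb, k, hk, hqk⟩ := hq
  exact eq_of_isOrthogonal_of_mem_boundary hpb hqb
    (hpl.isOrthogonal hqk (mul_lt_one_of_nonneg_of_lt_one_left (norm_nonneg l) hl hk.le).ne)

theorem IsAttracting.ne_of_isRepelling {A : Sp21} {a r : HP2} (ha : IsAttracting A a)
    (hr : IsRepelling A r) : a ≠ r := by
  rintro rfl
  obtain ⟨-, l, hl, hal⟩ := ha
  obtain ⟨-, k, hk, hrk⟩ := hr
  exact (hl.trans hk).ne (hal.norm_eq hrk)

theorem IsAttracting.smul_eq {A : Sp21} {a : HP2} (ha : IsAttracting A a) : A • a = a :=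
  smul_eq_self_iff_exists_isEigenpoint.2 (ha.2.imp fun _ h => h.2)

theorem IsRepelling.smul_eq {A : Sp21} {r : HP2} (hr : IsRepelling A r) : A • r = r :=
  smul_eq_self_iff_exists_isEigenpoint.2 (hr.2.imp fun _ h => h.2)

theorem IsAttracting.eq_or_eq_of_smul_eq {A : Sp21} {a r p : HP2} (ha : IsAttracting A a)
    (hr : IsRepelling A r) (hp : p ∈ boundary) (hAp : A • p = p) : p = a ∨ p = r := by
  obtain ⟨hab, l, hl, hal⟩ := ha
  obtain ⟨hrb, k, hk, hrk⟩ := hr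
  obtain ⟨m, hm⟩ := smul_eq_self_iff_exists_isEigenpoint.1 hAp
  by_contra! hne
  have hml := hm.norm_mul_norm_eq_one hal hp hab hne.1
  have hmk := hm.norm_mul_norm_eq_one hrk hp hrb hne.2
  have hm0 : ‖m‖ ≠ 0 := left_ne_zero_of_mul_eq_one hml
  exact (hl.trans hk).ne (mul_left_cancel₀ hm0 (hml.trans hmk.symm))

theorem IsAttracting.isPolar_iff {A : Sp21} {a r s : HP2} (ha : IsAttracting A a)
    (hr : IsRepelling A r) : IsPolar A s ↔ IsOrthogonal s a ∧ IsOrthogonal s r := by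
  constructor
  · rintro ⟨-, m, hm, hsm⟩
    obtain ⟨-, l, hl, hal⟩ := ha
    obtain ⟨-, k, hk, hrk⟩ := hr
    exact ⟨hsm.isOrthogonal hal (by simp [hm, hl.ne]), hsm.isOrthogonal hrk (by simp [hm, hk.ne'])⟩
  · intro hs
    have hne := ha.ne_of_isRepelling hr
    have hpos := mem_positivePoints_of_isOrthogonal ha.1 hr.1 hne hs.1 hs.2
    have hAs : IsOrthogonal (A • s) a ∧ IsOrthogonal (A • s) r :=
      ⟨by simpa only [ha.smul_eq] using hs.1.smul A, by simpa only [hr.smul_eq] using hs.2.smul A⟩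
    obtain ⟨m, hm⟩ := smul_eq_self_iff_exists_isEigenpoint.1
      ((existsUnique_isOrthogonal ha.1 hr.1 hne).unique hAs hs)
    refine ⟨hpos, m, ?_, hm⟩
    have hmm : ‖m‖ * ‖m‖ = 1 := by
      by_contra h
      exact not_isOrthogonal_self_of_mem_positivePoints hpos (hm.isOrthogonal hm h)
    exact (mul_self_eq_one_iff.1 hmm).resolve_right fun h => by linarith [norm_nonneg m]

/-! ### Conjugation -/

theorem mat_mul (A B : Sp21) : mat (A * B) = mat A * mat B := rfl

theorem mat_mul_inv (A : Sp21) : mat A * mat A⁻¹ = 1 := by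
  rw [← mat_mul, mul_inv_cancel]; rfl

theorem mat_inv_mul (A : Sp21) : mat A⁻¹ * mat A = 1 := by
  rw [← mat_mul, inv_mul_cancel]; rfl

theorem mat_injective : Function.Injective mat :=
  fun _ _ h => Subtype.ext (Units.ext h)

theorem IsEigenpoint.conj (g : Sp21) {A : Sp21} {p : HP2} {l : ℍ[ℝ]} (h : IsEigenpoint A p l) :
    IsEigenpoint (g * A * g⁻¹) (g • p) l := by
  obtain ⟨v, hv, rfl, hAv⟩ := h
  refine ⟨mat g *ᵥ v, mulVec_ne_zero g hv, rfl, ?_⟩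
  rw [← Matrix.mulVec_smul, ← hAv]
  simp only [mat_mul, Matrix.mulVec_mulVec, mul_assoc, mat_inv_mul, mul_one]

theorem IsAttracting.conj (g : Sp21) {A : Sp21} {p : HP2} (h : IsAttracting A p) :
    IsAttracting (g * A * g⁻¹) (g • p) :=
  ⟨smul_mem_boundary g h.1, h.2.imp fun _ h => ⟨h.1, h.2.conj g⟩⟩

theorem IsRepelling.conj (g : Sp21) {A : Sp21} {p : HP2} (h : IsRepelling A p) :
    IsRepelling (g * A * g⁻¹) (g • p) :=
  ⟨smul_mem_boundary g h.1, h.2.imp fun _ h => ⟨h.1, h.2.conj g⟩⟩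

theorem IsFixedQuadruple.conj (g : Sp21) {A B : Sp21} {q q' : Quadruple}
    (h : IsFixedQuadruple A B q) (hq : ∀ i, g • q.1 i = q'.1 i) :
    IsFixedQuadruple (g * A * g⁻¹) (g * B * g⁻¹) q' := by
  refine ⟨?_, ?_, ?_, ?_⟩ <;> rw [← hq]
  exacts [h.1.conj g, h.2.1.conj g, h.2.2.1.conj g, h.2.2.2.conj g]

/-! ### Frames -/

theorem conjTranspose_mul_H₁_mul_apply (M : Matrix (Fin 3) (Fin 3) ℍ[ℝ]) (i j : Fin 3) :
    (Mᴴ * H₁ * M) i j = herm (M.col j) (M.col i) := by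
  rw [mul_assoc]; rfl

theorem H₁_mul_H₁ : H₁ * H₁ = 1 := by
  ext1 i j
  fin_cases i <;> fin_cases j <;> simp [H₁, Matrix.mul_apply, Fin.sum_univ_three]

theorem exists_mat_eq {M : Matrix (Fin 3) (Fin 3) ℍ[ℝ]} (hM : Mᴴ * H₁ * M = H₁) :
    ∃ F : Sp21, mat F = M := by
  have left_inv : (H₁ * Mᴴ * H₁) * M = 1 := by
    rw [mul_assoc, mul_assoc, ← mul_assoc Mᴴ, hM, H₁_mul_H₁]
  exact ⟨⟨⟨M, H₁ * Mᴴ * H₁, mul_eq_one_comm.1 left_inv, left_inv⟩, hM⟩, rfl⟩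

theorem herm_col_zero_col_two (F : Sp21) : herm ((mat F).col 0) ((mat F).col 2) = 1 := by
  have hF : (mat F)ᴴ * H₁ * mat F = H₁ := F.2
  rw [← conjTranspose_mul_H₁_mul_apply, hF]
  simp [H₁]

theorem exists_frame_of_normalized {v x w : V} (hvv : herm v v = 0) (hww : herm w w = 0)
    (hvw : herm v w = 1) (hxv : herm x v = 0) (hxw : herm x w = 0) (hxx : herm x x = 1) :
    ∃ F : Sp21, (mat F).col 0 = v ∧ (mat F).col 1 = x ∧ (mat F).col 2 = w := by
  have hwv : herm w v = 1 := by rw [← star_herm, hvw, star_one]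
  let M : Matrix (Fin 3) (Fin 3) ℍ[ℝ] := (Matrix.of ![v, x, w])ᵀ
  have hcol (i : Fin 3) : M.col i = ![v, x, w] i := rfl
  obtain ⟨F, hF⟩ : ∃ F : Sp21, mat F = M := exists_mat_eq <| by
    ext1 i j
    rw [conjTranspose_mul_H₁_mul_apply, hcol, hcol]
    fin_cases i <;> fin_cases j <;>
      simp [H₁, hvv, hww, hvw, hwv, hxv, hxw, hxx, herm_comm_eq_zero.1 hxv,
        herm_comm_eq_zero.1 hxw]
  exact ⟨F, by rw [hF, hcol]; rfl, by rw [hF, hcol]; rfl, by rw [hF, hcol]; rfl⟩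

theorem exists_frame {v x w : V} (hvv : herm v v = 0) (hww : herm w w = 0) (hvw : herm v w ≠ 0)
    (hxv : herm x v = 0) (hxw : herm x w = 0) (hxx : 0 < (herm x x).re) :
    ∃ F : Sp21, (mat F).col 0 = v ∧ (∃ t : ℝ, (mat F).col 1 = x <• (t : ℍ[ℝ])) ∧
      ∃ q : ℍ[ℝ], q ≠ 0 ∧ (mat F).col 2 = w <• q := by
  set t : ℝ := (√(herm x x).re)⁻¹ with ht
  have htt : (herm x x).re * (t * t) = 1 := by
    rw [ht, ← mul_inv, Real.mul_self_sqrt hxx.le, mul_inv_cancel₀ hxx.ne']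
  set q : ℍ[ℝ] := star (herm v w)⁻¹ with hq
  have hvw' : herm v (w <• q) = 1 := by rw [herm_smul_right, hq, star_star, inv_mul_cancel₀ hvw]
  have hww' : herm (w <• q) (w <• q) = 0 := by simp [herm_smul_smul_self, hww]
  have hxx' : herm (x <• (t : ℍ[ℝ])) (x <• (t : ℍ[ℝ])) = 1 := by
    rw [herm_smul_smul_self, Quaternion.normSq_coe, sq, htt, Quaternion.coe_one]
  have hxv' : herm (x <• (t : ℍ[ℝ])) v = 0 := by rw [herm_smul_left, hxv, zero_mul]
  have hxw' : herm (x <• (t : ℍ[ℝ])) (w <• q) = 0 := by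
    rw [herm_smul_left, herm_smul_right, hxw, mul_zero, zero_mul]
  obtain ⟨F, h0, h1, h2⟩ := exists_frame_of_normalized hvv hww' hvw' hxv' hxw' hxx'
  exact ⟨F, h0, ⟨t, h1⟩, q, star_ne_zero.2 (inv_ne_zero hvw), h2⟩

theorem exists_frame_of_mk {v x w : V} (hv : v ≠ 0) (hx : x ≠ 0) (hw : w ≠ 0)
    (hvb : Projectivization.mk (ℍ[ℝ])ᵐᵒᵖ v hv ∈ boundary)
    (hwb : Projectivization.mk (ℍ[ℝ])ᵐᵒᵖ w hw ∈ boundary)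
    (hne : Projectivization.mk (ℍ[ℝ])ᵐᵒᵖ v hv ≠ .mk _ w hw)
    (hxv : IsOrthogonal (.mk _ x hx) (.mk _ v hv))
    (hxw : IsOrthogonal (.mk _ x hx) (.mk _ w hw)) :
    ∃ F : Sp21, (mat F).col 0 = v ∧ (∃ t : ℝ, (mat F).col 1 = x <• (t : ℍ[ℝ])) ∧
      ∃ q : ℍ[ℝ], q ≠ 0 ∧ (mat F).col 2 = w <• q :=
  exists_frame ((mk_mem_boundary_iff hv).1 hvb) ((mk_mem_boundary_iff hw).1 hwb)
    ((isOrthogonal_mk_iff hv hw).not.1 (mt (eq_of_isOrthogonal_of_mem_boundary hvb hwb) hne))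
    ((isOrthogonal_mk_iff hx hv).1 hxv) ((isOrthogonal_mk_iff hx hw).1 hxw)
    (herm_self_pos_of_mk_mem_positivePoints hx
      (mem_positivePoints_of_isOrthogonal hvb hwb hne hxv hxw))

/-! ### The complex representation -/

theorem complexPart₁_mul (p q : ℍ[ℝ]) : complexPart₁ (p * q) =
    complexPart₁ p * complexPart₁ q - star (complexPart₂ p) * complexPart₂ q := by
  apply Complex.ext <;> simp [complexPart₁, complexPart₂] <;> ring

theorem complexPart₂_mul (p q : ℍ[ℝ]) : complexPart₂ (p * q) =
    complexPart₂ p * complexPart₁ q + star (complexPart₁ p) * complexPart₂ q := by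
  apply Complex.ext <;> simp [complexPart₁, complexPart₂] <;> ring

theorem complexPart₁_add (p q : ℍ[ℝ]) :
    complexPart₁ (p + q) = complexPart₁ p + complexPart₁ q := by
  apply Complex.ext <;> simp [complexPart₁]

theorem complexPart₂_add (p q : ℍ[ℝ]) :
    complexPart₂ (p + q) = complexPart₂ p + complexPart₂ q := by
  apply Complex.ext <;> simp [complexPart₂, add_comm]

theorem toComplex_mul (M N : Matrix (Fin 3) (Fin 3) ℍ[ℝ]) :
    toComplex (M * N) = toComplex M * toComplex N := by
  rw [toComplex, toComplex, toComplex, Matrix.fromBlocks_multiply]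
  congr 1 <;> ext1 i j <;>
    simp [Matrix.mul_apply, Fin.sum_univ_three, complexPart₁_add, complexPart₂_add,
      complexPart₁_mul, complexPart₂_mul] <;> ring

theorem charpoly_toComplex_eq_of_mul_eq_mul {M N : Matrix (Fin 3) (Fin 3) ℍ[ℝ]} {F : Sp21}
    (h : M * mat F = mat F * N) : (toComplex M).charpoly = (toComplex N).charpoly := by
  have hM : M = mat F * N * mat F⁻¹ := by rw [← h, mul_assoc, mat_mul_inv, mul_one]
  rw [hM, toComplex_mul, Matrix.charpoly_mul_comm, ← toComplex_mul, ← mul_assoc, mat_inv_mul,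
    one_mul]

theorem realTrace_conj (g A : Sp21) : realTrace (g * A * g⁻¹) = realTrace A := by
  have h : mat (g * A * g⁻¹) * mat g = mat g * mat A := by
    rw [← mat_mul, inv_mul_cancel_right, mat_mul]
  rw [realTrace, charpoly_toComplex_eq_of_mul_eq_mul h, realTrace]

theorem toComplex_diagonal (d : Fin 3 → ℂ) :
    toComplex (Matrix.diagonal fun i => (d i : ℍ[ℝ])) =
      Matrix.fromBlocks (Matrix.diagonal d) 0 0 (Matrix.diagonal fun i => star (d i)) := by
  rw [toComplex]
  congr 1 <;> ext1 i j <;> by_cases h : i = j <;>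
    simp [h, complexPart₁, complexPart₂, Complex.ext_iff]

theorem charpoly_toComplex_diagonal (d : Fin 3 → ℂ) :
    (toComplex (Matrix.diagonal fun i => (d i : ℍ[ℝ]))).charpoly =
      ∏ i, (X - C (d i)) * (X - C (star (d i))) := by
  rw [toComplex_diagonal, Matrix.charpoly_fromBlocks_zero₂₁, Matrix.charpoly_diagonal,
    Matrix.charpoly_diagonal, Finset.prod_mul_distrib]

/-! ### Eigenframes -/

/-- The complex eigenvalue representatives of a hyperbolic element, for its attracting, polar and
repelling eigenlines in this order. -/
noncomputable def eigenvalues (l m : ℂ) : Fin 3 → ℂ := ![l, m, (star l)⁻¹]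

/-- The columns of `F` span the attracting, polar and repelling eigenlines of `A`, and are scaled so
that the eigenvalues are complex with nonnegative imaginary part. -/
structure IsEigenframe (A F : Sp21) (l m : ℂ) : Prop where
  norm_left : ‖l‖ < 1
  im_left : 0 ≤ l.im
  norm_right : ‖m‖ = 1
  im_right : 0 ≤ m.im
  mul_eq : mat A * mat F = mat F * Matrix.diagonal fun i => (eigenvalues l m i : ℍ[ℝ])

namespace IsEigenframe

variable {A A' F F' : Sp21} {l m l' m' : ℂ}

theorem of_mulVec_col {k : ℍ[ℝ]} (hl : ‖l‖ < 1) (hl' : 0 ≤ l.im) (hm : ‖m‖ = 1) (hm' : 0 ≤ m.im)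
    (h0 : mat A *ᵥ (mat F).col 0 = (mat F).col 0 <• (l : ℍ[ℝ]))
    (h1 : mat A *ᵥ (mat F).col 1 = (mat F).col 1 <• (m : ℍ[ℝ]))
    (h2 : mat A *ᵥ (mat F).col 2 = (mat F).col 2 <• k) : IsEigenframe A F l m := by
  obtain rfl : k = ((star l)⁻¹ : ℂ) := by
    rw [coeComplex_inv, coeComplex_star]
    exact eigenvalue_eq_inv_star (herm_col_zero_col_two F) h0 h2
  refine ⟨hl, hl', hm, hm', Matrix.ext_of_mulVec_single fun i => ?_⟩
  rw [← Matrix.mulVec_mulVec, ← Matrix.mulVec_mulVec, Matrix.mulVec_single_one]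
  have hdiag (d : Fin 3 → ℍ[ℝ]) : Matrix.diagonal d *ᵥ Pi.single i 1 = Pi.single i 1 <• d i := by
    ext1 j
    by_cases h : j = i <;> simp [Matrix.mulVec_diagonal, h]
  rw [hdiag, Matrix.mulVec_smul, Matrix.mulVec_single_one]
  fin_cases i
  exacts [h0, h1, h2]

theorem left_ne_zero (h : IsEigenframe A F l m) : l ≠ 0 := by
  have hinv : mat F⁻¹ * mat A⁻¹ * mat F *
      Matrix.diagonal (fun i => (eigenvalues l m i : ℍ[ℝ])) = 1 := by
    rw [mul_assoc, ← h.mul_eq, mul_assoc, ← mul_assoc (mat A⁻¹), mat_inv_mul, one_mul, mat_inv_mul]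
  have hentry := congrFun₂ hinv 0 0
  rintro rfl
  simp [Matrix.mul_diagonal, eigenvalues] at hentry

protected theorem eq (h : IsEigenframe A F l m) (h' : IsEigenframe A' F l m) : A = A' := by
  have e : mat A * mat F = mat A' * mat F := h.mul_eq.trans h'.mul_eq.symm
  exact mul_right_cancel (mat_injective e)

theorem charpoly_eq_prod (h : IsEigenframe A F l m) : (toComplex (mat A)).charpoly =
    ∏ i, (X - C (eigenvalues l m i)) * (X - C (star (eigenvalues l m i))) := by
  rw [charpoly_toComplex_eq_of_mul_eq_mul h.mul_eq, charpoly_toComplex_diagonal]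

end IsEigenframe

theorem X_sub_C_mul_X_sub_C_star (z : ℂ) :
    (X - C z) * (X - C (star z)) =
      X ^ 2 - C ((2 * z.re : ℝ) : ℂ) * X + C (Complex.normSq z : ℂ) := by
  rw [← Complex.add_conj z, ← Complex.mul_conj z]
  simp only [C_add, C_mul, Complex.star_def]
  ring

theorem mul_quadratics_eq_sextic {R : Type*} [CommRing R] {n n' : R} (h : n * n' = 1) (s t x : R) :
    (x ^ 2 - s * x + n) * (x ^ 2 - t * x + 1) * (x ^ 2 - s * n' * x + n') =
      x ^ 6 - (s + s * n' + t) * x ^ 5 + (n + n' + s ^ 2 * n' + 1 + t * (s + s * n')) * x ^ 4 -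
        (2 * (s + s * n') + t * (n + n' + s ^ 2 * n')) * x ^ 3 +
        (n + n' + s ^ 2 * n' + 1 + t * (s + s * n')) * x ^ 2 - (s + s * n' + t) * x + 1 := by
  linear_combination (1 - s * x) * (x ^ 2 - t * x + 1) * h

/-- The self-reciprocal sextic `x⁶ - a x⁵ + b x⁴ - c x³ + b x² - a x + 1` that has `(a, b, c)` as
its real trace. -/
noncomputable def traceSextic (t : ℝ × ℝ × ℝ) : ℂ[X] :=
  X ^ 6 - C (t.1 : ℂ) * X ^ 5 + C (t.2.1 : ℂ) * X ^ 4 - C (t.2.2 : ℂ) * X ^ 3 +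
    C (t.2.1 : ℂ) * X ^ 2 - C (t.1 : ℂ) * X + 1

theorem realTrace_eq_of_charpoly_eq {A : Sp21} {t : ℝ × ℝ × ℝ}
    (h : (toComplex (mat A)).charpoly = traceSextic t) : realTrace A = t := by
  rw [realTrace, h]
  simp [traceSextic, coeff_one, coeff_X_pow]

theorem exists_prod_eigenvalues_eq_traceSextic {l m : ℂ} (hl : l ≠ 0) (hm : ‖m‖ = 1) :
    ∃ t, ∏ i, (X - C (eigenvalues l m i)) * (X - C (star (eigenvalues l m i))) =
      traceSextic t := by
  set n := Complex.normSq l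
  set s := 2 * l.re
  set t := 2 * m.re
  have hnn' : C (n : ℂ) * C ((n⁻¹ : ℝ) : ℂ) = 1 := by
    rw [← C_mul, ← Complex.ofReal_mul, mul_inv_cancel₀ (mt Complex.normSq_eq_zero.1 hl),
      Complex.ofReal_one, C_1]
  have normSq_m : Complex.normSq m = 1 := by rw [Complex.normSq_eq_norm_sq, hm, one_pow]
  have normSq_inv : Complex.normSq (star l)⁻¹ = n⁻¹ := by simp [n]
  have re_inv : 2 * (star l)⁻¹.re = s * n⁻¹ := by
    simp [s, n, Complex.inv_re, div_eq_mul_inv, mul_assoc]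
  refine ⟨(s + s * n⁻¹ + t, n + n⁻¹ + s ^ 2 * n⁻¹ + 1 + t * (s + s * n⁻¹),
    2 * (s + s * n⁻¹) + t * (n + n⁻¹ + s ^ 2 * n⁻¹)), ?_⟩
  calc
    _ = (X ^ 2 - C (s : ℂ) * X + C (n : ℂ)) * (X ^ 2 - C (t : ℂ) * X + 1) *
        (X ^ 2 - C (s : ℂ) * C ((n⁻¹ : ℝ) : ℂ) * X + C ((n⁻¹ : ℝ) : ℂ)) := by
      simp only [X_sub_C_mul_X_sub_C_star, Fin.prod_univ_three, eigenvalues,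
        Matrix.cons_val_zero, Matrix.cons_val_one, Matrix.cons_val]
      rw [normSq_m, normSq_inv, re_inv, Complex.ofReal_one, C_1, Complex.ofReal_mul s, C_mul]
    _ = traceSextic _ := by
      rw [mul_quadratics_eq_sextic hnn']
      simp only [traceSextic, Complex.ofReal_add, Complex.ofReal_mul, Complex.ofReal_pow,
        Complex.ofReal_one, Complex.ofReal_ofNat, C_add, C_mul, C_pow, C_1, C_ofNat]

namespace IsEigenframe

variable {A A' F F' : Sp21} {l m l' m' : ℂ}

theorem charpoly_eq_traceSextic (h : IsEigenframe A F l m) :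
    (toComplex (mat A)).charpoly = traceSextic (realTrace A) := by
  obtain ⟨t, ht⟩ := exists_prod_eigenvalues_eq_traceSextic h.left_ne_zero h.norm_right
  have e := h.charpoly_eq_prod.trans ht
  rw [e, realTrace_eq_of_charpoly_eq e]

theorem im_eigenvalues (h : IsEigenframe A F l m) : ∀ i, 0 ≤ (eigenvalues l m i).im := by
  have him : 0 ≤ (star l)⁻¹.im := by
    rw [Complex.inv_im, Complex.star_def, Complex.conj_im, neg_neg]
    exact div_nonneg h.im_left (Complex.normSq_nonneg _)
  intro i
  fin_cases i
  exacts [h.im_left, h.im_right, him]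

theorem one_lt_norm_inv_star (h : IsEigenframe A F l m) : 1 < ‖(star l)⁻¹‖ := by
  rw [norm_inv, norm_star]
  exact (one_lt_inv₀ (norm_pos_iff.2 h.left_ne_zero)).2 h.norm_left

theorem exists_eq_eigenvalues (h : IsEigenframe A F l m) {z : ℂ} (him : 0 ≤ z.im)
    (hz : (toComplex (mat A)).charpoly.IsRoot z) : ∃ i, z = eigenvalues l m i := by
  rw [h.charpoly_eq_prod, IsRoot, eval_prod, Finset.prod_eq_zero_iff] at hz
  obtain ⟨i, -, hi⟩ := hz
  refine ⟨i, ?_⟩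
  simp only [eval_mul, eval_sub, eval_X, eval_C, mul_eq_zero, sub_eq_zero] at hi
  refine hi.elim id fun hstar => ?_
  have hzi : z.im = -(eigenvalues l m i).im := by rw [hstar, Complex.star_def, Complex.conj_im]
  have hzero : (eigenvalues l m i).im = 0 := by linarith [h.im_eigenvalues i]
  rw [hstar, Complex.star_def, Complex.conj_eq_iff_im.2 hzero]

theorem isRoot_eigenvalues (h : IsEigenframe A F l m) (i : Fin 3) :
    (toComplex (mat A)).charpoly.IsRoot (eigenvalues l m i) := by
  rw [h.charpoly_eq_prod, IsRoot, eval_prod]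
  exact Finset.prod_eq_zero (Finset.mem_univ i) (by simp)

theorem eigenvalues_eq (h : IsEigenframe A F l m) (h' : IsEigenframe A' F' l' m')
    (ht : realTrace A = realTrace A') : l = l' ∧ m = m' := by
  have hroot (i : Fin 3) : ∃ j, eigenvalues l m i = eigenvalues l' m' j := by
    refine h'.exists_eq_eigenvalues (h.im_eigenvalues i) ?_
    rw [h'.charpoly_eq_traceSextic, ← ht, ← h.charpoly_eq_traceSextic]
    exact h.isRoot_eigenvalues i
  have hl := h.norm_left
  have hm := h.norm_right
  have h₁ := h'.norm_left
  have h₂ := h'.norm_right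
  have h₃ := h'.one_lt_norm_inv_star
  constructor
  · obtain ⟨j, hj : l = _⟩ := hroot 0
    fin_cases j
    · exact hj
    · obtain rfl : l = m' := hj
      linarith
    · obtain rfl : l = (star l')⁻¹ := hj
      linarith
  · obtain ⟨j, hj : m = _⟩ := hroot 1
    fin_cases j
    · obtain rfl : m = l' := hj
      linarith
    · exact hj
    · obtain rfl : m = (star l')⁻¹ := hj
      linarith

end IsEigenframe

/-! ### Projective points -/

theorem isProjectivePoint_mk_iff {R : Reference} {A : Sp21} {p : HP2} {l : ℂ}
    {q : {q : ℍ[ℝ] // q ≠ 0}} : IsProjectivePoint R A p l ⟦q⟧ ↔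
      mat A *ᵥ (R.lift p <• q.1) = (R.lift p <• q.1) <• (l : ℍ[ℝ]) := by
  refine ⟨?_, fun h => ⟨q, rfl, h⟩⟩
  rintro ⟨q', hq', h⟩
  obtain ⟨c, -, hc⟩ : ∃ c : ℂ, c ≠ 0 ∧ q.1 = q'.1 * (c : ℍ[ℝ]) :=
    Quotient.exact hq'.symm
  have hlc : (l : ℍ[ℝ]) * c = c * l := by
    rw [← Quaternion.coeComplex_mul, mul_comm, Quaternion.coeComplex_mul]
  rw [hc, ← op_smul_op_smul]
  exact mulVec_smul_right_of_mul_eq_mul h hlc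

theorem exists_projectivePoint (R : Reference) {A : Sp21} {p : HP2} {k : ℍ[ℝ]}
    (h : IsEigenpoint A p k) :
    ∃ (l : ℂ) (P : CP1), ‖l‖ = ‖k‖ ∧ 0 ≤ l.im ∧ IsProjectivePoint R A p l P := by
  obtain ⟨k', hk', e⟩ := h.exists_mulVec (R.lift_ne_zero p) (R.mk_lift p)
  obtain ⟨q, l, hq, hl, hql⟩ := exists_mul_eq_mul_coeComplex k'
  have hn := norm_eq_of_mul_eq_mul hq hql
  rw [norm_coeComplex] at hn
  exact ⟨l, ⟦⟨q, hq⟩⟧, hn.trans hk', hl,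
    isProjectivePoint_mk_iff.2 (mulVec_smul_right_of_mul_eq_mul e hql)⟩

theorem IsAttracting.exists_firstProjectivePoint (R : Reference) {A : Sp21} {p : HP2}
    (h : IsAttracting A p) : ∃ P, IsFirstProjectivePoint R A P := by
  obtain ⟨k, hk, he⟩ := h.2
  obtain ⟨l, P, hl, him, hP⟩ := exists_projectivePoint R he
  exact ⟨P, p, l, h, hl ▸ hk, him, hP⟩

theorem IsPolar.exists_secondProjectivePoint (R : Reference) {A : Sp21} {p : HP2}
    (h : IsPolar A p) : ∃ P, IsSecondProjectivePoint R A P := by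
  obtain ⟨k, hk, he⟩ := h.2
  obtain ⟨m, P, hm, him, hP⟩ := exists_projectivePoint R he
  exact ⟨P, p, m, h, hm ▸ hk, him, hP⟩

theorem smul_lift_ne_zero (R : Reference) (p : HP2) {q : ℍ[ℝ]} (hq : q ≠ 0) :
    R.lift p <• q ≠ 0 :=
  smul_ne_zero ((op_ne_zero_iff q).2 hq) (R.lift_ne_zero p)

theorem mk_smul_lift (R : Reference) (p : HP2) {q : ℍ[ℝ]} (hq : q ≠ 0) :
    Projectivization.mk (ℍ[ℝ])ᵐᵒᵖ (R.lift p <• q) (smul_lift_ne_zero R p hq) = p := by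
  conv_rhs => rw [← R.mk_lift p]
  exact (mk_eq_mk_iff_smul_right _ _).2 ⟨q, rfl⟩

theorem IsSecondProjectivePoint.exists_isProjectivePoint {R : Reference} {A : Sp21} {a r s : HP2}
    {P : CP1} (h : IsSecondProjectivePoint R A P) (ha : IsAttracting A a) (hr : IsRepelling A r)
    (hsa : IsOrthogonal s a) (hsr : IsOrthogonal s r) :
    ∃ m : ℂ, ‖m‖ = 1 ∧ 0 ≤ m.im ∧ IsProjectivePoint R A s m P := by
  obtain ⟨p, m, hp, hm, him, hP⟩ := h
  obtain rfl : p = s := (existsUnique_isOrthogonal ha.1 hr.1 (ha.ne_of_isRepelling hr)).unique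
    ((ha.isPolar_iff hr).1 hp) ⟨hsa, hsr⟩
  exact ⟨m, hm, him, hP⟩

theorem IsFirstProjectivePoint.exists_isProjectivePoint {R : Reference} {A : Sp21} {a : HP2}
    {P : CP1} (h : IsFirstProjectivePoint R A P) (ha : IsAttracting A a) :
    ∃ l : ℂ, ‖l‖ < 1 ∧ 0 ≤ l.im ∧ IsProjectivePoint R A a l P := by
  obtain ⟨p, l, hp, hl, him, hP⟩ := h
  obtain rfl := ha.unique hp
  exact ⟨l, hl, him, hP⟩

/-- The frame is chosen before the element: it depends only on the fixed points and the projective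
points. -/
theorem exists_forall_isEigenframe (R : Reference) {a r : HP2} (ha : a ∈ boundary)
    (hr : r ∈ boundary) (hne : a ≠ r) (P Q : CP1) :
    ∃ F, ∀ A, IsAttracting A a → IsRepelling A r → IsFirstProjectivePoint R A P →
      IsSecondProjectivePoint R A Q → ∃ l m, IsEigenframe A F l m := by
  obtain ⟨s, hsa, hsr⟩ := (existsUnique_isOrthogonal ha hr hne).exists
  obtain ⟨q, rfl⟩ := Quotient.exists_rep P
  obtain ⟨b, rfl⟩ := Quotient.exists_rep Q
  have mk_v := mk_smul_lift R a q.2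
  have mk_x := mk_smul_lift R s b.2
  have mk_w := R.mk_lift r
  obtain ⟨F, h0, ⟨t, h1⟩, c, hc, h2⟩ := exists_frame_of_mk (smul_lift_ne_zero R a q.2)
    (smul_lift_ne_zero R s b.2) (R.lift_ne_zero r) (by rwa [mk_v]) (by rwa [mk_w])
    (by rwa [mk_v, mk_w]) (by rwa [mk_x, mk_v]) (by rwa [mk_x, mk_w])
  refine ⟨F, fun A hAa hAr hP hQ => ?_⟩
  obtain ⟨l, hl, hl', hlP⟩ := hP.exists_isProjectivePoint hAa
  obtain ⟨m, hm, hm', hmQ⟩ := hQ.exists_isProjectivePoint hAa hAr hsa hsr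
  obtain ⟨-, k, -, hk⟩ := hAr
  have hAv := isProjectivePoint_mk_iff.1 hlP
  have hAx := mulVec_smul_right_of_mul_eq_mul (isProjectivePoint_mk_iff.1 hmQ)
    (Quaternion.coe_commutes t m).symm
  obtain ⟨k', -, hAw⟩ := hk.exists_mulVec (R.lift_ne_zero r) mk_w
  obtain ⟨k₂, -, hAwc⟩ := exists_mulVec_smul_right hAw hc
  rw [← h0] at hAv
  rw [← h1] at hAx
  rw [← h2] at hAwc
  exact ⟨l, m, .of_mulVec_col hl hl' hm hm' hAv hAx hAwc⟩

theorem eq_of_projectivePoints {R : Reference} {A A' : Sp21} {a r : HP2} {P Q : CP1}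
    (ha : IsAttracting A a) (ha' : IsAttracting A' a) (hr : IsRepelling A r)
    (hr' : IsRepelling A' r) (ht : realTrace A = realTrace A')
    (hP : IsFirstProjectivePoint R A P) (hP' : IsFirstProjectivePoint R A' P)
    (hQ : IsSecondProjectivePoint R A Q) (hQ' : IsSecondProjectivePoint R A' Q) : A = A' := by
  obtain ⟨F, hF⟩ := exists_forall_isEigenframe R ha.1 hr.1 (ha.ne_of_isRepelling hr) P Q
  obtain ⟨l, m, h⟩ := hF A ha hr hP hQ
  obtain ⟨l', m', h'⟩ := hF A' ha' hr' hP' hQ'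
  obtain ⟨rfl, rfl⟩ := h.eigenvalues_eq h' ht
  exact h.eq h'

/-! ### Parameters of a pair -/

theorem exists_projectivePoints (R : Reference) {A : Sp21} {a r : HP2} (ha : IsAttracting A a)
    (hr : IsRepelling A r) :
    ∃ P Q, IsFirstProjectivePoint R A P ∧ IsSecondProjectivePoint R A Q := by
  obtain ⟨s, hs⟩ := (existsUnique_isOrthogonal ha.1 hr.1 (ha.ne_of_isRepelling hr)).exists
  obtain ⟨P, hP⟩ := ha.exists_firstProjectivePoint R
  obtain ⟨Q, hQ⟩ := ((ha.isPolar_iff hr).2 hs).exists_secondProjectivePoint R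
  exact ⟨P, Q, hP, hQ⟩

theorem exists_hasParameters (R : Reference) {A B : Sp21} (hA : IsHyperbolic A)
    (hB : IsHyperbolic B) : ∃ w, HasParameters R A B w := by
  obtain ⟨a, r, ha, hr⟩ := hA.exists_attracting_repelling
  obtain ⟨a', r', ha', hr'⟩ := hB.exists_attracting_repelling
  let q : Quadruple := ⟨![a, r, a', r'], fun i => by
    fin_cases i
    exacts [ha.1, hr.1, ha'.1, hr'.1]⟩
  have hq : IsFixedQuadruple A B q := ⟨ha, hr, ha', hr'⟩
  obtain ⟨g, hg⟩ : ∃ g : Sp21, ∀ i, g • q.1 i = (R.quad ⟦q⟧).1 i :=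
    Quotient.exact (R.quad_class ⟦q⟧).symm
  have hgq := hq.conj g hg
  obtain ⟨P, Q, hP, hQ⟩ := exists_projectivePoints R hgq.1 hgq.2.1
  obtain ⟨P', Q', hP', hQ'⟩ := exists_projectivePoints R hgq.2.2.1 hgq.2.2.2
  exact ⟨⟨realTrace A, realTrace B, ⟦q⟧, P, Q, P', Q'⟩, rfl, rfl, ⟨q, hq, rfl⟩, g, hgq, hP, hQ,
    hP', hQ'⟩

theorem HasParameters.conj {R : Reference} {A B : Sp21} {w : Parameters}
    (h : HasParameters R A B w) (g : Sp21) :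
    HasParameters R (g * A * g⁻¹) (g * B * g⁻¹) w := by
  obtain ⟨hA, hB, ⟨q, hq, hqw⟩, k, hk⟩ := h
  let gq : Quadruple := ⟨fun i => g • q.1 i, fun i => smul_mem_boundary g (q.2 i)⟩
  have hgq : (⟦gq⟧ : Configuration) = ⟦q⟧ := Quotient.sound (Setoid.symm ⟨g, fun _ => rfl⟩)
  have hconj (M : Sp21) : k * g⁻¹ * (g * M * g⁻¹) * (k * g⁻¹)⁻¹ = k * M * k⁻¹ := by group
  refine ⟨(realTrace_conj g A).trans hA, (realTrace_conj g B).trans hB,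
    ⟨gq, hq.conj g fun _ => rfl, hgq.trans hqw⟩, k * g⁻¹, ?_⟩
  rwa [hconj, hconj]

theorem ConjugatePairs.symm {A B A' B' : Sp21} (h : ConjugatePairs A B A' B') :
    ConjugatePairs A' B' A B := by
  obtain ⟨g, rfl, rfl⟩ := h
  exact ⟨g⁻¹, by group, by group⟩

theorem ConjugatePairs.hasParameters {R : Reference} {A B A' B' : Sp21} {w : Parameters}
    (h : ConjugatePairs A B A' B') (hw : HasParameters R A B w) : HasParameters R A' B' w := by
  obtain ⟨g, rfl, rfl⟩ := h
  exact hw.conj g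

theorem conj_eq_of_conj_eq_conj {G : Type*} [Group G] {g h x y : G}
    (e : g * x * g⁻¹ = h * y * h⁻¹) : h⁻¹ * g * x * (h⁻¹ * g)⁻¹ = y := by
  calc h⁻¹ * g * x * (h⁻¹ * g)⁻¹ = h⁻¹ * (g * x * g⁻¹) * h := by group
    _ = y := by rw [e]; group

theorem HasParameters.conjugatePairs {R : Reference} {A B A' B' : Sp21} {w : Parameters}
    (h : HasParameters R A B w) (h' : HasParameters R A' B' w) : ConjugatePairs A B A' B' := by
  obtain ⟨hA, hB, -, g, ⟨ha, hr, hb, hs⟩, hP, hQ, hP₂, hQ₂⟩ := h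
  obtain ⟨hA', hB', -, g', ⟨ha', hr', hb', hs'⟩, hP', hQ', hP₂', hQ₂'⟩ := h'
  have eA : g * A * g⁻¹ = g' * A' * g'⁻¹ := eq_of_projectivePoints ha ha' hr hr'
    (by rw [realTrace_conj, realTrace_conj, hA, hA']) hP hP' hQ hQ'
  have eB : g * B * g⁻¹ = g' * B' * g'⁻¹ := eq_of_projectivePoints hb hb' hs hs'
    (by rw [realTrace_conj, realTrace_conj, hB, hB']) hP₂ hP₂' hQ₂ hQ₂'
  exact ⟨g'⁻¹ * g, conj_eq_of_conj_eq_conj eA, conj_eq_of_conj_eq_conj eB⟩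

theorem mk_mem_M2_iff (q : Quadruple) : (⟦q⟧ : Configuration) ∈ M2 ↔ Function.Injective q.1 := by
  constructor
  · rintro ⟨q', hinj, h⟩
    obtain ⟨g, hg⟩ : ∃ g : Sp21, ∀ i, g • q'.1 i = q.1 i := Quotient.exact h
    intro i j hij
    rw [← hg, ← hg] at hij
    exact hinj (smul_left_cancel g hij)
  · exact fun h => ⟨q, h, rfl⟩

theorem IsFixedQuadruple.injective_iff {A B : Sp21} {q : Quadruple} (hq : IsFixedQuadruple A B q) :
    Function.Injective q.1 ↔ ∀ p ∈ boundary, ¬ (A • p = p ∧ B • p = p) := by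
  obtain ⟨ha, hr, hb, hs⟩ := hq
  constructor
  · rintro hinj p hp ⟨hAp, hBp⟩
    obtain rfl | rfl := ha.eq_or_eq_of_smul_eq hr hp hAp <;>
      obtain h | h := hb.eq_or_eq_of_smul_eq hs hp hBp <;>
      exact absurd (hinj h) (by decide)
  · intro hcommon i j hij
    have ne_of_fixed {i j} (hi : A • q.1 i = q.1 i) (hj : B • q.1 j = q.1 j) : q.1 i ≠ q.1 j :=
      fun e => hcommon _ (q.2 i) ⟨hi, e ▸ hj⟩
    have h01 := ha.ne_of_isRepelling hr
    have h23 := hb.ne_of_isRepelling hs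
    have h02 := ne_of_fixed ha.smul_eq hb.smul_eq
    have h03 := ne_of_fixed ha.smul_eq hs.smul_eq
    have h12 := ne_of_fixed hr.smul_eq hb.smul_eq
    have h13 := ne_of_fixed hr.smul_eq hs.smul_eq
    fin_cases i <;> fin_cases j <;> first
      | rfl
      | exact absurd hij ‹_›
      | exact absurd hij.symm ‹_›

theorem HasParameters.config_mem_M2_iff {R : Reference} {A B : Sp21} {w : Parameters}
    (h : HasParameters R A B w) :
    w.config ∈ M2 ↔ ∀ p ∈ boundary, ¬ (A • p = p ∧ B • p = p) := by
  obtain ⟨-, -, ⟨q, hq, hqw⟩, -⟩ := h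
  rw [← hqw, mk_mem_M2_iff, hq.injective_iff]

end QuatHyp

theorem theorem1p2_general (R : Reference) {A B : Sp21} (hA : IsHyperbolic A)
    (hB : IsHyperbolic B) :
    (∃ w, HasParameters R A B w) ∧
    (∀ w, HasParameters R A B w →
      (w.config ∈ M2 ↔ ∀ p ∈ boundary, ¬ (A • p = p ∧ B • p = p))) ∧
    ∀ A' B',
      (ConjugatePairs A B A' B' ↔ ∃ w, HasParameters R A B w ∧ HasParameters R A' B' w) ∧
      (ConjugatePairs A B A' B' ↔ ∀ w, HasParameters R A B w ↔ HasParameters R A' B' w) := by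
  obtain ⟨w₀, hw₀⟩ := exists_hasParameters R hA hB
  refine ⟨⟨w₀, hw₀⟩, fun w hw => hw.config_mem_M2_iff, fun A' B' => ⟨⟨?_, ?_⟩, ?_, ?_⟩⟩
  · exact fun h => ⟨w₀, hw₀, h.hasParameters hw₀⟩
  · exact fun ⟨w, hw, hw'⟩ => hw.conjugatePairs hw'
  · exact fun h w => ⟨h.hasParameters, h.symm.hasParameters⟩
  · exact fun h => hw₀.conjugatePairs ((h w₀).1 hw₀)

theorem theorem1p2 (R : Reference) (A B : Sp21) (hAB : TotallyLoxodromic A B) :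
    (∃ w : Parameters, HasParameters R A B w) ∧
    (∀ w : Parameters, HasParameters R A B w →
      (w.config ∈ M2 ↔ ∀ p ∈ boundary, ¬ (A • p = p ∧ B • p = p))) ∧
    ∀ A' B' : Sp21, TotallyLoxodromic A' B' →
      (ConjugatePairs A B A' B' ↔
        ∃ w : Parameters, HasParameters R A B w ∧ HasParameters R A' B' w) ∧
      (ConjugatePairs A B A' B' ↔
        ∀ w : Parameters, HasParameters R A B w ↔ HasParameters R A' B' w) := by
  obtain ⟨hex, hconfig, hconj⟩ := theorem1p2_general R hAB.1.1 hAB.2.1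
  exact ⟨hex, hconfig, fun A' B' _ => hconj A' B'⟩
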